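/- **Setting.** Let $c\ge 1$ be an integer, $\beta>0$, and let $(b_j)_{j\ge 0}$, $(h_j)_{j\ge 1}$ be real numbers with $b_j\ge 0$ for $j\ne 1$, $h_j\ge0$ for $j\ge 1$, $0<-b_1=\sum_{j\ne 1}b_j<\infty$, $b_0>0$, $\sum_{j\ge 2}b_j>0$ and $0<h:=\sum_{j\ge1}h_j<\infty$. Let $Q^*=(q^*_{ij})_{i,j\ge 0}$ be given by $q^*_{i,i-1}=\min(i,c)b_0$, $q^*_{ii}=b_1-(\min(i,c)-1)b_0$ and $q^*_{ij}=b_{j-i+1}$ $(j>i)$ for $i\ge 1$, all other entries being $0$. Let $Q=Q^*+Q_s+Q_d$, where $Q_s$ has the entries $q^{(s)}_{00}=-h$, $q^{(s)}_{0j}=h_j$ $(j\ge1)$ and $0$ otherwise, and $Q_d$ has the entries $q^{(d)}_{i0}=\beta$, $q^{(d)}_{ii}=-\beta$ $(i\ge1)$ and $0$ otherwise. Let $(p_{ij}(t))$ and $(p^*_{ij}(t))$ be the transition functions of the Feller minimal $Q$-process and $Q^*$-process. Put $$B(s)=\sum_{j\ge0}b_js^j,\quad B_c(s)=B(s)+(c-1)b_0(1-s),\quad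 U_\beta(s)=B_c(s)-\beta s,\quad H(s)=\sum_{j\ge1}h_js^j,$$ $$L_j(\beta)=\sum_{i\ge1}h_i\int_0^\infty e^{-\beta t}p^*_{ij}(t)\,dt ,$$ and let $u(\beta)$ be the root of $U_\beta$ on $[0,1]$. **Theorem.** The root $u(\beta)$ lies in $(0,1)$ and is the only root of $U_\beta$ on $[-1,1]$. The $Q$-process has an equilibrium distribution $(\pi_j)_{j\ge0}$, that is, a unique stationary probability distribution $(\pi_j)$, and $p_{ij}(t)\to\pi_j$ as $t\to\infty$ for all $i,j\ge0$. Its generating function $\Pi(s)=\sum_{k\ge0}\pi_ks^k$ satisfies, for all $s\in[-1,1]$ with $s\neq u(\beta)$, $$\Pi(s)=\pi_0\Big[1+\frac{s(H(u(\beta))-H(s))}{U_\beta(s)}\Big]+\frac{\sum_{k=1}^{c-1}\pi_k(c-k)b_0\big[s^k(1-s)-s\,u(\beta)^{k-1}(1-u(\beta))\big]}{U_\beta(s)} .$$ Furthermore, $$\pi_0=\beta\Big[\beta+h-H(u(\beta))+\sum_{k=1}^{c-1}L_k(\beta)u(\beta)^{k-1}(c-k)b_0(1-u(\beta))\Big]^{-1},\qquad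 \pi_j=\pi_0L_j(\beta)\quad(j\ge1).$$ -/

import Mathlib

open Set Filter Topology MeasureTheory
open scoped ENNReal

namespace MXMc

noncomputable section

/-! ### The `q`-matrices of the queue

States are natural numbers. The data are the number `c` of servers, a sequence `b`, a sequence
`h` (only the values `h j` with `j ≥ 1` are ever used), and the catastrophe rate `β`. -/

/-- The `q`-matrix `Q*` of the queue stopped when it becomes empty. -/
def qStar (c : ℕ) (b : ℕ → ℝ) (i j : ℕ) : ℝ :=
  if i = 0 then 0
  else if j + 1 = i then ((min i c : ℕ) : ℝ) * b 0
  else if j = i then b 1 - (((min i c : ℕ) : ℝ) - 1) * b 0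
  else if i < j then b (j - i + 1)
  else 0

/-- The total resurrection rate `h = ∑_{j ≥ 1} h_j`. -/
def hTotal (h : ℕ → ℝ) : ℝ := ∑' j : ℕ, h (j + 1)

/-- The `q`-matrix `Q_s` of the resurrection at the empty state. -/
def qRes (h : ℕ → ℝ) (i j : ℕ) : ℝ :=
  if i = 0 then (if j = 0 then -hTotal h else h j) else 0

/-- The `q`-matrix `Q_d` of the catastrophes. -/
def qCat (β : ℝ) (i j : ℕ) : ℝ :=
  if i = 0 then 0
  else if j = 0 then β
  else if j = i then -β
  else 0

/-- The `q`-matrix `Q = Q* + Q_s + Q_d` of the queue with resurrection and catastrophes. -/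
def qMatrix (c : ℕ) (b h : ℕ → ℝ) (β : ℝ) (i j : ℕ) : ℝ :=
  qStar c b i j + qRes h i j + qCat β i j

/-! ### The Feller minimal process of a `q`-matrix -/

/-- Feller's iteration for the backward integral equation of a `q`-matrix `Q`:
the `n`-th iterate is the probability to be in `j` at time `t`, starting from `i`, after fewer than
`n` jumps. -/
def fellerIter (Q : ℕ → ℕ → ℝ) : ℕ → ℝ → ℕ → ℕ → ℝ≥0∞
  | 0, _, _, _ => 0
  | n + 1, t, i, j =>
      (if i = j then ENNReal.ofReal (Real.exp (Q i i * t)) else 0) +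
        ∫⁻ s in Icc (0 : ℝ) t, ENNReal.ofReal (Real.exp (Q i i * s)) *
          ∑' k : ℕ, if k = i then 0 else ENNReal.ofReal (Q i k) * fellerIter Q n (t - s) k j

/-- The transition function `p_ij(t)` (`t ≥ 0`) of the Feller minimal `Q`-process: the limit of the
nondecreasing sequence of Feller's iterates. -/
def transition (Q : ℕ → ℕ → ℝ) (t : ℝ) (i j : ℕ) : ℝ :=
  (⨆ n : ℕ, fellerIter Q n t i j).toReal

/-- The resolvent `∫_0^∞ e^{-λ t} p_ij(t) dt` of the Feller minimal `Q`-process. -/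
def resolvent (Q : ℕ → ℕ → ℝ) (lam : ℝ) (i j : ℕ) : ℝ :=
  ∫ t in Ioi (0 : ℝ), Real.exp (-(lam * t)) * transition Q t i j

/-- `π` is a stationary probability distribution of the transition function `P`. -/
structure IsStationaryDistribution (P : ℝ → ℕ → ℕ → ℝ) (π : ℕ → ℝ) : Prop where
  nonneg : ∀ j, 0 ≤ π j
  hasSum_one : HasSum π 1
  invariant : ∀ t : ℝ, 0 ≤ t → ∀ j, HasSum (fun i => π i * P t i j) (π j)

/-- `π` is the equilibrium distribution of the transition function `P`: it is the only stationary
probability distribution, and the limit law from every initial state. -/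
structure IsEquilibriumDistribution (P : ℝ → ℕ → ℕ → ℝ) (π : ℕ → ℝ) : Prop where
  stationary : IsStationaryDistribution P π
  unique : ∀ ν : ℕ → ℝ, IsStationaryDistribution P ν → ν = π
  limit : ∀ i j, Tendsto (fun t => P t i j) atTop (𝓝 (π j))

/-! ### Generating functions and the quantities `u(λ)`, `L_j(λ)` -/

/-- `B(s) = ∑_{j ≥ 0} b_j s^j`. -/
def genB (b : ℕ → ℝ) (s : ℝ) : ℝ := ∑' j : ℕ, b j * s ^ j

/-- `B_i(s) = B(s) + (i - 1) b_0 (1 - s)`. -/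
def genBi (b : ℕ → ℝ) (i : ℕ) (s : ℝ) : ℝ := genB b s + ((i : ℝ) - 1) * b 0 * (1 - s)

/-- `H(s) = ∑_{j ≥ 1} h_j s^j`. -/
def genH (h : ℕ → ℝ) (s : ℝ) : ℝ := ∑' j : ℕ, h (j + 1) * s ^ (j + 1)

/-- `U_λ(s) = B_c(s) - λ s`. -/
def genU (c : ℕ) (b : ℕ → ℝ) (lam s : ℝ) : ℝ := genBi b c s - lam * s

/-- `u(λ)`, the root of `U_λ` on `[0, 1]`, here taken as the smallest one. -/
def rootU (c : ℕ) (b : ℕ → ℝ) (lam : ℝ) : ℝ :=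
  sInf {s : ℝ | s ∈ Icc (0 : ℝ) 1 ∧ genU c b lam s = 0}

/-- `L_j(λ) = ∑_{i ≥ 1} h_i φ*_ij(λ)`, with `φ*` the resolvent of the `Q*`-process. -/
def bigL (c : ℕ) (b h : ℕ → ℝ) (lam : ℝ) (j : ℕ) : ℝ :=
  ∑' i : ℕ, h (i + 1) * resolvent (qStar c b) lam (i + 1) j

end

end MXMc

open MXMc

/-!
All `q`-matrices involved are bounded, so the Feller minimal `Q`-process is the semigroup `exp (tQ)`
acting on `ℓ¹` by row vectors. On vectors of total mass `0` the catastrophes only contribute a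
factor: `exp (tQ) = e^{-βt} exp (t(Q* + Q_s))` there. Hence any probability vector `x` with `xQ = 0`
attracts every other one at the rate `e^{-βt}`, and is the equilibrium distribution. Such an `x` is
proportional to `(1, L_1(β), L_2(β), …)`: the `β`-resolvent of `Q*` applied to `(0, h_1, h_2, …)`
solves all the equations except the one at state `0`, which follows since the rows of `Q` sum to
`0`.

The generating function of `xQ = 0`, times `s`, is an identity of the form
`U_β(s) (Π(s) - π_0) = s R(s)`. The convex function `U_β` has a single root `u` in `(0, 1)`, so
`R(u) = 0`. This equation determines `π_0`, and replacing `R(s)` by `R(s) - R(u)` gives the formula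
for `Π`.
-/

namespace MXMc

open NormedSpace (exp)
open scoped lp

/-! ### Exponentials of bounded operators -/

section Exponential

variable {E F 𝔸 : Type*} [NormedAddCommGroup E] [NormedSpace ℝ E] [CompleteSpace E]
  [NormedAddCommGroup F] [NormedSpace ℝ F] [NormedRing 𝔸] [NormedAlgebra ℝ 𝔸]

lemma hasSum_exp_apply (A : E →L[ℝ] E) (x : E) :
    HasSum (fun n : ℕ => (n.factorial : ℝ)⁻¹ • (A ^ n) x) (exp A x) := by
  simpa using (NormedSpace.exp_series_hasSum_exp' (𝕂 := ℝ) A).mapL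
    (ContinuousLinearMap.apply ℝ E x)

lemma exp_apply_eq_of_eqOn {A A' : E →L[ℝ] E} {S : Set E} (hS : MapsTo A' S S) (hA : EqOn A A' S)
    {x : E} (hx : x ∈ S) : exp A x = exp A' x := by
  have hpow : ∀ n : ℕ, (A' ^ n) x ∈ S ∧ (A ^ n) x = (A' ^ n) x := by
    intro n
    induction n with
    | zero => simpa using hx
    | succ n ih =>
      simp only [pow_succ', mul_apply_eq_comp, ih.2]
      exact ⟨hS ih.1, hA ih.1⟩
  refine (hasSum_exp_apply A x).unique ?_
  simpa only [(hpow _).2] using hasSum_exp_apply A' x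

lemma exp_apply_of_apply_eq_zero {A : E →L[ℝ] E} {x : E} (hx : A x = 0) : exp A x = x := by
  have h : exp A x = exp (0 : E →L[ℝ] E) x :=
    exp_apply_eq_of_eqOn (S := {y | A y = 0}) (A' := 0) (fun _ _ => map_zero A)
      (fun _ hy => hy) hx
  simpa using h

lemma map_exp_apply_of_comp_eq_zero {A : E →L[ℝ] E} {φ : E →L[ℝ] F} (h : φ ∘L A = 0) (x : E) :
    φ (exp A x) = φ x := by
  refine ((hasSum_exp_apply A x).mapL φ).unique ?_
  convert hasSum_ite_eq (0 : ℕ) (φ x) using 2 with n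
  cases n with
  | zero => simp
  | succ n =>
    have hφ : ∀ y, φ (A y) = 0 := DFunLike.congr_fun h
    simp [pow_succ', hφ]

lemma norm_exp_smul_exp_smul_le {A : 𝔸} {lam t : ℝ} (hA : ‖exp (t • A)‖ ≤ 1) :
    ‖Real.exp (-(lam * t)) • exp (t • A)‖ ≤ Real.exp (-(lam * t)) := by
  rw [norm_smul, Real.norm_of_nonneg (Real.exp_pos _).le]
  exact mul_le_of_le_one_right (Real.exp_pos _).le hA

variable [CompleteSpace 𝔸]

lemma exp_add_smul_one (A : 𝔸) (a : ℝ) : exp (A + a • (1 : 𝔸)) = Real.exp a • exp A := by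
  let +nondep : NormedAlgebra ℚ 𝔸 := NormedAlgebra.restrictScalars ℚ ℝ 𝔸
  have h := NormedSpace.algebraMap_exp_comm (𝕂 := ℝ) (𝔸 := 𝔸) a
  rw [Algebra.algebraMap_eq_smul_one, Algebra.algebraMap_eq_smul_one] at h
  rw [NormedSpace.exp_add_of_commute ((Commute.one_right A).smul_right a), ← h, mul_smul_comm,
    mul_one, Real.exp_eq_exp_ℝ]

lemma continuous_exp_smul (A : 𝔸) : Continuous fun t : ℝ => exp (t • A) :=
  continuous_iff_continuousAt.2 fun t => (hasDerivAt_exp_smul_const A t).continuousAt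

lemma exp_smul_apply_eq_add_integral {A : E →L[ℝ] E} {x y : E} {a : ℝ} (h : A x = y + a • x)
    (t : ℝ) : exp (t • A) x =
      Real.exp (a * t) • x + ∫ s in (0 : ℝ)..t, Real.exp (a * s) • exp ((t - s) • A) y := by
  have hderiv : ∀ s : ℝ, HasDerivAt (fun s => Real.exp (a * s) • exp ((t - s) • A) x)
      (-(Real.exp (a * s) • exp ((t - s) • A) y)) s := by
    intro s
    have hscalar : HasDerivAt (fun s => Real.exp (a * s)) (Real.exp (a * s) * a) s := by
      simpa using ((hasDerivAt_id s).const_mul a).exp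
    have hexp : HasDerivAt (fun s : ℝ => exp ((t - s) • A) x)
        (-(exp ((t - s) • A) (A x))) s := by
      have := ((hasDerivAt_exp_smul_const A (t - s)).scomp s
        ((hasDerivAt_id s).const_sub t)).clm_apply (hasDerivAt_const s x)
      simpa using this
    refine (hscalar.smul hexp).congr_deriv ?_
    rw [h, map_add, map_smul]
    module
  have hcont : Continuous fun s : ℝ => -(Real.exp (a * s) • exp ((t - s) • A) y) := by
    have := (continuous_exp_smul A).comp (continuous_const.sub continuous_id : Continuous (t - ·))
    fun_prop
  have hFTC := intervalIntegral.integral_eq_sub_of_hasDerivAt (fun s _ => hderiv s)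
    (hcont.intervalIntegrable 0 t)
  simp only [intervalIntegral.integral_neg, sub_self, zero_smul, NormedSpace.exp_zero, sub_zero,
    mul_zero, Real.exp_zero, one_smul, one_apply_eq_self] at hFTC
  rw [← neg_eq_iff_eq_neg.2 hFTC.symm]
  abel

/-- The Laplace transform `∫₀^∞ e^{-λt} exp(tA) dt` at `λ` of the group generated by `A`. -/
noncomputable def laplaceExp (A : 𝔸) (lam : ℝ) : 𝔸 :=
  ∫ t in Ioi (0 : ℝ), Real.exp (-(lam * t)) • exp (t • A)

variable {A : 𝔸} {lam : ℝ}

lemma integrableOn_exp_smul_exp_smul (hA : ∀ t : ℝ, 0 ≤ t → ‖exp (t • A)‖ ≤ 1) (hl : 0 < lam) :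
    IntegrableOn (fun t : ℝ => Real.exp (-(lam * t)) • exp (t • A)) (Ioi 0) := by
  have hcont : Continuous fun t : ℝ => Real.exp (-(lam * t)) • exp (t • A) := by
    have := continuous_exp_smul A
    fun_prop
  have hdom : IntegrableOn (fun t : ℝ => Real.exp (-(lam * t))) (Ioi 0) := by
    simpa using exp_neg_integrableOn_Ioi 0 hl
  refine hdom.mono' hcont.aestronglyMeasurable ?_
  filter_upwards [ae_restrict_mem measurableSet_Ioi] with t ht
  exact norm_exp_smul_exp_smul_le (hA t (le_of_lt ht))

lemma tendsto_exp_neg_mul_atTop (hl : 0 < lam) :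
    Tendsto (fun t : ℝ => Real.exp (-(lam * t))) atTop (𝓝 0) :=
  Real.tendsto_exp_neg_atTop_nhds_zero.comp (tendsto_id.const_mul_atTop hl)

lemma mul_laplaceExp (hA : ∀ t : ℝ, 0 ≤ t → ‖exp (t • A)‖ ≤ 1) (hl : 0 < lam) :
    A * laplaceExp A lam = lam • laplaceExp A lam - 1 := by
  set D : 𝔸 := A + (-lam) • (1 : 𝔸) with hD
  have hexp : ∀ t : ℝ, Real.exp (-(lam * t)) • exp (t • A) = exp (t • D) := fun t => by
    rw [← exp_add_smul_one, hD]
    congr 1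
    module
  have hlim : Tendsto (fun t : ℝ => exp (t • D)) atTop (𝓝 0) := by
    refine squeeze_zero_norm' ?_ (tendsto_exp_neg_mul_atTop hl)
    filter_upwards [eventually_ge_atTop 0] with t ht
    exact hexp t ▸ norm_exp_smul_exp_smul_le (hA t ht)
  have hint : IntegrableOn (fun t : ℝ => exp (t • D)) (Ioi 0) := by
    simpa only [hexp] using integrableOn_exp_smul_exp_smul hA hl
  have hFTC := integral_Ioi_of_hasDerivAt_of_tendsto'
    (fun t _ => hasDerivAt_exp_smul_const' D t) (hint.const_mul D) hlim
  have hDL : D * laplaceExp A lam = -1 := by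
    simpa [laplaceExp, hexp, ← integral_const_mul_of_integrable hint] using hFTC
  rw [hD, add_mul, smul_mul_assoc, one_mul] at hDL
  rw [sub_eq_add_neg, ← hDL]
  module

end Exponential

/-! ### Operators on `ℓ¹` -/

section LOne

variable {ι F : Type*} [NormedAddCommGroup F] [NormedSpace ℝ F]

/-- A summable real family as an element of `ℓ¹`. -/
def ofSummable (f : ι → ℝ) (hf : Summable f) : ℓ¹(ι, ℝ) :=
  ⟨f, memℓp_gen (by simpa using hf.abs)⟩

/-- The `j`-th coordinate functional on `ℓ¹`. -/
noncomputable def coord (j : ι) : ℓ¹(ι, ℝ) →L[ℝ] ℝ := lp.evalCLM ℝ (fun _ => ℝ) 1 j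

@[simp] lemma coord_apply (j : ι) (x : ℓ¹(ι, ℝ)) : coord j x = x j := rfl

/-- The total mass `∑ⱼ xⱼ` of a summable family. -/
noncomputable def mass : ℓ¹(ι, ℝ) →L[ℝ] ℝ := lp.tsumCLM ℝ ι ℝ

lemma hasSum_mass (x : ℓ¹(ι, ℝ)) : HasSum x (mass x) :=
  (Memℓp.summable_of_one x.2).hasSum

lemma mass_ofSummable {f : ι → ℝ} {a : ℝ} (hf : HasSum f a) :
    mass (ofSummable f hf.summable) = a :=
  hf.tsum_eq

lemma hasSum_abs (x : ℓ¹(ι, ℝ)) : HasSum (fun i => |x i|) ‖x‖ := by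
  simpa using lp.hasSum_norm (p := 1) (by simp) x

lemma abs_apply_le_norm (x : ℓ¹(ι, ℝ)) (j : ι) : |x j| ≤ ‖x‖ :=
  lp.norm_apply_le_norm one_ne_zero x j

lemma norm_eq_mass {x : ℓ¹(ι, ℝ)} (hx : 0 ≤ ⇑x) : ‖x‖ = mass x :=
  (hasSum_abs x).unique (by simpa only [abs_of_nonneg (hx _)] using hasSum_mass x)

/-- The operator on `ℓ¹` mapping the `i`-th unit vector to `r i`, for a bounded family `r`. -/
noncomputable def ofRows [CompleteSpace F] :
    lp (fun _ : ι => F) ∞ →L[ℝ] ℓ¹(ι, ℝ) →L[ℝ] F :=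
  (lp.dualPairing 1 ∞ (fun _ => ContinuousLinearMap.lsmul ℝ ℝ) (K := 1)
    fun _ => ContinuousLinearMap.opNorm_lsmul_le).flip

/-- An operator on `ℓ¹` that preserves the cone of nonnegative families. -/
def IsPositiveOperator (T : ℓ¹(ι, ℝ) →L[ℝ] ℓ¹(ι, ℝ)) : Prop :=
  ∀ ⦃x : ℓ¹(ι, ℝ)⦄, 0 ≤ ⇑x → 0 ≤ ⇑(T x)

namespace IsPositiveOperator

variable {T : ℓ¹(ι, ℝ) →L[ℝ] ℓ¹(ι, ℝ)}

lemma smul {a : ℝ} (ha : 0 ≤ a) (hT : IsPositiveOperator T) : IsPositiveOperator (a • T) :=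
  fun _ hx j => mul_nonneg ha (hT hx j)

lemma pow (hT : IsPositiveOperator T) (n : ℕ) : IsPositiveOperator (T ^ n) := by
  induction n with
  | zero => exact fun _ hx => hx
  | succ n ih => exact fun x hx => by simpa only [pow_succ', mul_apply_eq_comp] using hT (ih hx)

lemma exp (hT : IsPositiveOperator T) : IsPositiveOperator (exp T) := fun x hx j =>
  ((hasSum_exp_apply T x).mapL (coord j)).nonneg fun n => by
    simpa using mul_nonneg (by positivity) (hT.pow n hx j)

end IsPositiveOperator

variable [DecidableEq ι]

/-- The `i`-th unit vector of `ℓ¹`. -/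
noncomputable def unitVec (i : ι) : ℓ¹(ι, ℝ) := lp.single 1 i 1

lemma unitVec_apply (i j : ι) : unitVec i j = if i = j then 1 else 0 := by
  simp [unitVec, Pi.single_apply, eq_comm]

@[simp] lemma unitVec_apply_self (i : ι) : unitVec i i = 1 := by simp [unitVec_apply]

lemma unitVec_apply_of_ne {i j : ι} (h : i ≠ j) : unitVec i j = 0 := by simp [unitVec_apply, h]

lemma unitVec_nonneg (i : ι) : 0 ≤ ⇑(unitVec i) := fun j => by
  rw [unitVec_apply]; split_ifs <;> norm_num

lemma norm_unitVec (i : ι) : ‖unitVec i‖ = 1 := by simp [unitVec, lp.norm_single]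

@[simp] lemma mass_unitVec (i : ι) : mass (unitVec i) = 1 := by
  rw [← norm_eq_mass (unitVec_nonneg i), norm_unitVec]

lemma ofRows_unitVec [CompleteSpace F] (r : lp (fun _ : ι => F) ∞) (i : ι) :
    ofRows r (unitVec i) = r i := by
  change ∑' k, unitVec i k • r k = r i
  rw [tsum_eq_single i fun k hk => by rw [unitVec_apply_of_ne hk.symm, zero_smul]]
  simp

lemma hasSum_map (T : ℓ¹(ι, ℝ) →L[ℝ] F) (x : ℓ¹(ι, ℝ)) :
    HasSum (fun i => x i • T (unitVec i)) (T x) := by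
  have hx : HasSum (fun i => x i • unitVec i) x := by
    simpa [unitVec, ← lp.single_smul] using lp.hasSum_single (p := 1) (by simp) x
  simpa using hx.mapL T

lemma hasSum_map_apply (T : ℓ¹(ι, ℝ) →L[ℝ] ℓ¹(ι, ℝ)) (x : ℓ¹(ι, ℝ)) (j : ι) :
    HasSum (fun i => x i * T (unitVec i) j) (T x j) := by
  simpa using (hasSum_map T x).mapL (coord j)

lemma ext_unitVec {T T' : ℓ¹(ι, ℝ) →L[ℝ] F} (h : ∀ i, T (unitVec i) = T' (unitVec i)) :
    T = T' := by
  refine ContinuousLinearMap.ext fun x => (hasSum_map T x).unique ?_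
  simpa only [h] using hasSum_map T' x

lemma opNorm_le_of_unitVec {T : ℓ¹(ι, ℝ) →L[ℝ] F} {C : ℝ} (hC : 0 ≤ C)
    (hT : ∀ i, ‖T (unitVec i)‖ ≤ C) : ‖T‖ ≤ C := by
  refine T.opNorm_le_bound hC fun x => ?_
  rw [← (hasSum_map T x).tsum_eq]
  refine tsum_of_norm_bounded ((hasSum_abs x).mul_left C) fun i => ?_
  rw [norm_smul, Real.norm_eq_abs, mul_comm]
  gcongr
  exact hT i

lemma IsPositiveOperator.of_unitVec {T : ℓ¹(ι, ℝ) →L[ℝ] ℓ¹(ι, ℝ)}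
    (hT : ∀ i, 0 ≤ ⇑(T (unitVec i))) : IsPositiveOperator T := fun x hx j =>
  (hasSum_map_apply T x j).nonneg fun i => mul_nonneg (hx i) (hT i j)

end LOne

/-! ### Bounded conservative `q`-matrices -/

/-- `Q` is a conservative `q`-matrix whose exit rates are at most `M`. -/
structure IsBoundedQMatrix {ι : Type*} (Q : ι → ι → ℝ) (M : ℝ) : Prop where
  nonneg : ∀ ⦃i j⦄, i ≠ j → 0 ≤ Q i j
  hasSum : ∀ i, HasSum (Q i) 0
  neg_diag_le : ∀ i, -Q i i ≤ M

namespace IsBoundedQMatrix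

variable {ι : Type*} {Q Q' : ι → ι → ℝ} {M M' : ℝ}

lemma add (hQ : IsBoundedQMatrix Q M) (hQ' : IsBoundedQMatrix Q' M') :
    IsBoundedQMatrix (Q + Q') (M + M') where
  nonneg _ _ hij := add_nonneg (hQ.nonneg hij) (hQ'.nonneg hij)
  hasSum i := add_zero (0 : ℝ) ▸ (hQ.hasSum i).add (hQ'.hasSum i)
  neg_diag_le i := by
    simpa [add_comm] using add_le_add (hQ.neg_diag_le i) (hQ'.neg_diag_le i)

variable (hQ : IsBoundedQMatrix Q M)

include hQ in
lemma diag_nonpos (i : ι) : Q i i ≤ 0 := le_hasSum (hQ.hasSum i) i fun _ hj => hQ.nonneg hj.symm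

include hQ in
lemma bound_nonneg (i : ι) : 0 ≤ M := by linarith [hQ.diag_nonpos i, hQ.neg_diag_le i]

/-- The `i`-th row of `Q` as an element of `ℓ¹`. -/
def row (i : ι) : ℓ¹(ι, ℝ) := ofSummable (Q i) (hQ.hasSum i).summable

lemma row_eq_zero {i : ι} (hi : ∀ j, Q i j = 0) : hQ.row i = 0 := by
  ext j
  exact hi j

lemma mass_row (i : ι) : mass (hQ.row i) = 0 := mass_ofSummable (hQ.hasSum i)

lemma row_add_nonneg [DecidableEq ι] (i : ι) : 0 ≤ ⇑(hQ.row i + M • unitVec i) := fun j => by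
  change 0 ≤ Q i j + M * unitVec i j
  rcases eq_or_ne i j with rfl | hij
  · rw [unitVec_apply_self]; linarith [hQ.neg_diag_le i]
  · simpa [unitVec_apply_of_ne hij] using hQ.nonneg hij

lemma norm_row_le (i : ι) : ‖hQ.row i‖ ≤ 2 * M := by
  classical
  have hM : ‖M • unitVec i‖ = M := by
    rw [norm_smul, norm_unitVec, mul_one, Real.norm_of_nonneg (hQ.bound_nonneg i)]
  have hrow : ‖hQ.row i + M • unitVec i‖ = M := by
    simp [norm_eq_mass (hQ.row_add_nonneg i), mass_row]
  calc ‖hQ.row i‖ = ‖(hQ.row i + M • unitVec i) - M • unitVec i‖ := by rw [add_sub_cancel_right]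
    _ ≤ ‖hQ.row i + M • unitVec i‖ + ‖M • unitVec i‖ := norm_sub_le _ _
    _ = 2 * M := by rw [hrow, hM, two_mul]

/-- The generator `x ↦ xQ` on `ℓ¹`. -/
noncomputable def gen : ℓ¹(ι, ℝ) →L[ℝ] ℓ¹(ι, ℝ) :=
  ofRows ⟨hQ.row, memℓp_infty ⟨2 * M, forall_mem_range.2 hQ.norm_row_le⟩⟩

@[simp] lemma gen_unitVec [DecidableEq ι] (i : ι) : hQ.gen (unitVec i) = hQ.row i :=
  ofRows_unitVec _ i

lemma gen_add (hQ' : IsBoundedQMatrix Q' M') : (hQ.add hQ').gen = hQ.gen + hQ'.gen := by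
  classical
  refine ext_unitVec fun i => ?_
  rw [add_apply, gen_unitVec, gen_unitVec, gen_unitVec]
  rfl

lemma mass_comp_gen : mass ∘L hQ.gen = 0 := by
  classical
  exact ext_unitVec fun i => by simp [mass_row]

@[simp] lemma mass_gen (x : ℓ¹(ι, ℝ)) : mass (hQ.gen x) = 0 :=
  DFunLike.congr_fun hQ.mass_comp_gen x

/-- The semigroup `exp (tQ)` on `ℓ¹`. -/
noncomputable def semigroup (t : ℝ) : ℓ¹(ι, ℝ) →L[ℝ] ℓ¹(ι, ℝ) := exp (t • hQ.gen)

lemma continuous_semigroup : Continuous hQ.semigroup := continuous_exp_smul hQ.gen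

@[simp] lemma mass_semigroup (t : ℝ) (x : ℓ¹(ι, ℝ)) : mass (hQ.semigroup t x) = mass x :=
  map_exp_apply_of_comp_eq_zero (by rw [ContinuousLinearMap.comp_smul, mass_comp_gen, smul_zero]) x

lemma semigroup_apply_of_gen_eq_zero {x : ℓ¹(ι, ℝ)} (hx : hQ.gen x = 0) (t : ℝ) :
    hQ.semigroup t x = x :=
  exp_apply_of_apply_eq_zero (by rw [smul_apply, hx, smul_zero])

/-- Since `Q + M` has nonnegative entries, so has `exp (tQ) = exp (-tM) exp (t(Q + M))`. -/
lemma isPositiveOperator_semigroup {t : ℝ} (ht : 0 ≤ t) :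
    IsPositiveOperator (hQ.semigroup t) := by
  classical
  have hpos : IsPositiveOperator (hQ.gen + M • 1) :=
    .of_unitVec fun i => by simpa using hQ.row_add_nonneg i
  have hexp : hQ.semigroup t = Real.exp (-(t * M)) • exp (t • (hQ.gen + M • 1)) := by
    rw [← exp_add_smul_one, semigroup]
    congr 1
    module
  exact hexp ▸ (hpos.smul ht).exp.smul (Real.exp_pos _).le

lemma norm_semigroup_le {t : ℝ} (ht : 0 ≤ t) : ‖hQ.semigroup t‖ ≤ 1 := by
  classical
  refine opNorm_le_of_unitVec zero_le_one fun i => ?_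
  rw [norm_eq_mass (hQ.isPositiveOperator_semigroup ht (unitVec_nonneg i)), mass_semigroup,
    mass_unitVec]

/-- The resolvent `∫₀^∞ e^{-λt} exp (tQ) dt` on `ℓ¹`. -/
noncomputable def resolventOp (lam : ℝ) : ℓ¹(ι, ℝ) →L[ℝ] ℓ¹(ι, ℝ) := laplaceExp hQ.gen lam

variable {lam : ℝ}

lemma resolventOp_apply (hl : 0 < lam) (x : ℓ¹(ι, ℝ)) (j : ι) : hQ.resolventOp lam x j =
    ∫ t in Ioi (0 : ℝ), Real.exp (-(lam * t)) * hQ.semigroup t x j :=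
  ((coord j ∘L ContinuousLinearMap.apply ℝ _ x).integral_comp_comm
    (integrableOn_exp_smul_exp_smul (fun _ => hQ.norm_semigroup_le) hl)).symm

lemma isPositiveOperator_resolventOp (hl : 0 < lam) : IsPositiveOperator (hQ.resolventOp lam) :=
  fun x hx j => by
    rw [resolventOp_apply hQ hl]
    exact setIntegral_nonneg measurableSet_Ioi fun t ht =>
      mul_nonneg (Real.exp_pos _).le (hQ.isPositiveOperator_semigroup (le_of_lt ht) hx j)

lemma gen_resolventOp (hl : 0 < lam) (x : ℓ¹(ι, ℝ)) :
    hQ.gen (hQ.resolventOp lam x) = lam • hQ.resolventOp lam x - x :=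
  DFunLike.congr_fun (mul_laplaceExp (A := hQ.gen) (fun _ => hQ.norm_semigroup_le) hl) x

end IsBoundedQMatrix

/-! ### The Feller minimal process of a bounded `q`-matrix -/

/-- One step of Feller's iteration, the right-hand side of the backward integral equation. -/
noncomputable def fellerStep (Q : ℕ → ℕ → ℝ) (f : ℝ → ℕ → ℕ → ℝ≥0∞) (t : ℝ) (i j : ℕ) : ℝ≥0∞ :=
  (if i = j then ENNReal.ofReal (Real.exp (Q i i * t)) else 0) +
    ∫⁻ s in Icc (0 : ℝ) t, ENNReal.ofReal (Real.exp (Q i i * s)) *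
      ∑' k : ℕ, if k = i then 0 else ENNReal.ofReal (Q i k) * f (t - s) k j

lemma fellerIter_succ (Q : ℕ → ℕ → ℝ) (n : ℕ) :
    fellerIter Q (n + 1) = fellerStep Q (fellerIter Q n) := rfl

lemma fellerStep_mono {Q : ℕ → ℕ → ℝ} {f g : ℝ → ℕ → ℕ → ℝ≥0∞} {t : ℝ} {j : ℕ}
    (hfg : ∀ s, 0 ≤ s → ∀ k, f s k j ≤ g s k j) (i : ℕ) :
    fellerStep Q f t i j ≤ fellerStep Q g t i j := by
  refine add_le_add le_rfl (setLIntegral_mono' measurableSet_Icc fun s hs => ?_)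
  gcongr with k
  split_ifs
  · exact le_rfl
  · gcongr
    exact hfg _ (sub_nonneg.2 hs.2) k

lemma lintegral_pow_div_factorial {M t : ℝ} (hM : 0 ≤ M) (ht : 0 ≤ t) (n : ℕ) :
    ENNReal.ofReal M * ∫⁻ s in Icc (0 : ℝ) t, ENNReal.ofReal ((M * (t - s)) ^ n / n.factorial) =
      ENNReal.ofReal ((M * t) ^ (n + 1) / (n + 1).factorial) := by
  have hcont : Continuous fun s => (M * (t - s)) ^ n / (n.factorial : ℝ) := by fun_prop
  have hint : ∫ s in (0 : ℝ)..t, (M * (t - s)) ^ n / (n.factorial : ℝ) =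
      M ^ n * (t ^ (n + 1) / (n + 1)) / n.factorial := by
    rw [intervalIntegral.integral_comp_sub_left fun r => (M * r) ^ n / (n.factorial : ℝ)]
    simp [mul_pow, integral_pow]
  rw [← ofReal_integral_eq_lintegral_ofReal hcont.integrableOn_Icc
      ((ae_restrict_iff' measurableSet_Icc).2 (Eventually.of_forall fun s hs => by
        have := sub_nonneg.2 hs.2
        simp only [Pi.zero_apply]
        positivity)),
    integral_Icc_eq_integral_Ioc, ← intervalIntegral.integral_of_le ht, hint,
    ← ENNReal.ofReal_mul hM, Nat.factorial_succ]
  congr 1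
  push_cast
  field_simp
  ring

namespace IsBoundedQMatrix

variable {Q : ℕ → ℕ → ℝ} {M : ℝ} (hQ : IsBoundedQMatrix Q M)

/-- The `i`-th row of `Q` without its diagonal entry. -/
noncomputable def offDiagRow (i : ℕ) : ℓ¹(ℕ, ℝ) := hQ.row i - Q i i • unitVec i

lemma gen_unitVec_eq (i : ℕ) : hQ.gen (unitVec i) = hQ.offDiagRow i + Q i i • unitVec i := by
  rw [gen_unitVec, offDiagRow, sub_add_cancel]

lemma offDiagRow_apply (i k : ℕ) : hQ.offDiagRow i k = if k = i then 0 else Q i k := by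
  change Q i k - Q i i * unitVec i k = _
  rcases eq_or_ne k i with rfl | hki
  · simp
  · simp [hki, unitVec_apply_of_ne hki.symm]

lemma offDiagRow_nonneg (i : ℕ) : 0 ≤ ⇑(hQ.offDiagRow i) := fun k => by
  rw [offDiagRow_apply, Pi.zero_apply]
  split_ifs with h
  · exact le_rfl
  · exact hQ.nonneg (Ne.symm h)

include hQ in
lemma tsum_offDiag_le (i : ℕ) :
    ∑' k : ℕ, (if k = i then 0 else ENNReal.ofReal (Q i k)) ≤ ENNReal.ofReal M := by
  have hmass : mass (hQ.offDiagRow i) = -Q i i := by simp [offDiagRow, mass_row]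
  have hsum := hmass ▸ hasSum_mass (hQ.offDiagRow i)
  calc ∑' k : ℕ, (if k = i then 0 else ENNReal.ofReal (Q i k))
      = ∑' k : ℕ, ENNReal.ofReal (hQ.offDiagRow i k) :=
        tsum_congr fun k => by rw [offDiagRow_apply]; split_ifs <;> simp
    _ = ENNReal.ofReal (-Q i i) := by
        rw [← hsum.tsum_eq, ENNReal.ofReal_tsum_of_nonneg (hQ.offDiagRow_nonneg i) hsum.summable]
    _ ≤ ENNReal.ofReal M := ENNReal.ofReal_le_ofReal (hQ.neg_diag_le i)

include hQ in
lemma fellerStep_le_add {f g : ℝ → ℕ → ℕ → ℝ≥0∞} {ε : ℝ → ℝ≥0∞} (hε : Measurable ε) {t : ℝ}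
    {j : ℕ} (hfg : ∀ s, 0 ≤ s → ∀ k, f s k j ≤ g s k j + ε s) (i : ℕ) :
    fellerStep Q f t i j ≤
      fellerStep Q g t i j + ENNReal.ofReal M * ∫⁻ s in Icc (0 : ℝ) t, ε (t - s) := by
  have hexp : ∀ s, 0 ≤ s → ENNReal.ofReal (Real.exp (Q i i * s)) ≤ 1 := fun s hs =>
    ENNReal.ofReal_le_one.2 (Real.exp_le_one_iff.2 (mul_nonpos_of_nonpos_of_nonneg
      (hQ.diag_nonpos i) hs))
  have hsum : ∀ s, 0 ≤ s → (∑' k, if k = i then 0 else ENNReal.ofReal (Q i k) * f s k j) ≤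
      (∑' k, if k = i then 0 else ENNReal.ofReal (Q i k) * g s k j) + ENNReal.ofReal M * ε s := by
    intro s hs
    grw [← hQ.tsum_offDiag_le i]
    rw [← ENNReal.tsum_mul_right, ← ENNReal.tsum_add]
    gcongr with k
    split_ifs
    · simp
    · grw [hfg s hs k, mul_add]
  have hεt : Measurable fun s => ε (t - s) := hε.comp (by fun_prop)
  rw [fellerStep, fellerStep, add_assoc, ← lintegral_const_mul _ hεt,
    ← lintegral_add_right _ (hεt.const_mul _)]
  refine add_le_add le_rfl (setLIntegral_mono' measurableSet_Icc fun s hs => ?_)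
  grw [hsum _ (sub_nonneg.2 hs.2), mul_add]
  exact add_le_add le_rfl (mul_le_of_le_one_left zero_le (hexp s hs.1))

lemma continuous_semigroup_apply (x : ℓ¹(ℕ, ℝ)) (j : ℕ) :
    Continuous fun t => hQ.semigroup t x j :=
  (coord j ∘L ContinuousLinearMap.apply ℝ _ x).continuous.comp hQ.continuous_semigroup

lemma semigroup_unitVec_apply_eq_integral (t : ℝ) (i j : ℕ) :
    hQ.semigroup t (unitVec i) j = Real.exp (Q i i * t) * unitVec i j +
      ∫ s in (0 : ℝ)..t, Real.exp (Q i i * s) * hQ.semigroup (t - s) (hQ.offDiagRow i) j := by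
  have hcont : Continuous fun s =>
      Real.exp (Q i i * s) • hQ.semigroup (t - s) (hQ.offDiagRow i) := by
    have := hQ.continuous_semigroup.comp (continuous_const.sub continuous_id : Continuous (t - ·))
    fun_prop
  have hcoord := (coord j).intervalIntegral_comp_comm (hcont.intervalIntegrable (μ := volume) 0 t)
  simp only [map_smul, coord_apply, smul_eq_mul] at hcoord
  rw [hcoord]
  exact congrArg (coord j) (exp_smul_apply_eq_add_integral (hQ.gen_unitVec_eq i) t)

/-- The entries of `exp (tQ)` as extended nonnegative numbers. -/
noncomputable def semigroupENN (t : ℝ) (i j : ℕ) : ℝ≥0∞ :=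
  ENNReal.ofReal (hQ.semigroup t (unitVec i) j)

lemma ofReal_semigroup_offDiagRow {t : ℝ} (ht : 0 ≤ t) (i j : ℕ) :
    ENNReal.ofReal (hQ.semigroup t (hQ.offDiagRow i) j) =
      ∑' k : ℕ, if k = i then 0 else ENNReal.ofReal (Q i k) * hQ.semigroupENN t k j := by
  have hsum := hasSum_map_apply (hQ.semigroup t) (hQ.offDiagRow i) j
  have hpos : ∀ k, 0 ≤ hQ.semigroup t (unitVec k) j := fun k =>
    hQ.isPositiveOperator_semigroup ht (unitVec_nonneg k) j
  rw [← hsum.tsum_eq, ENNReal.ofReal_tsum_of_nonneg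
    (fun k => mul_nonneg (hQ.offDiagRow_nonneg i k) (hpos k)) hsum.summable]
  refine tsum_congr fun k => ?_
  rw [ENNReal.ofReal_mul (hQ.offDiagRow_nonneg i k), offDiagRow_apply]
  split_ifs <;> simp [semigroupENN]

lemma fellerStep_semigroupENN {t : ℝ} (ht : 0 ≤ t) (i j : ℕ) :
    fellerStep Q hQ.semigroupENN t i j = hQ.semigroupENN t i j := by
  have hnonneg : ∀ s ∈ Icc (0 : ℝ) t,
      0 ≤ Real.exp (Q i i * s) * hQ.semigroup (t - s) (hQ.offDiagRow i) j := fun s hs =>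
    mul_nonneg (Real.exp_pos _).le
      (hQ.isPositiveOperator_semigroup (sub_nonneg.2 hs.2) (hQ.offDiagRow_nonneg i) j)
  have hcont : Continuous fun s =>
      Real.exp (Q i i * s) * hQ.semigroup (t - s) (hQ.offDiagRow i) j := by
    have := (hQ.continuous_semigroup_apply (hQ.offDiagRow i) j).comp
      (continuous_const.sub continuous_id : Continuous (t - ·))
    fun_prop
  rw [semigroupENN, semigroup_unitVec_apply_eq_integral, ENNReal.ofReal_add
    (mul_nonneg (Real.exp_pos _).le (unitVec_nonneg i j))
    (intervalIntegral.integral_nonneg ht hnonneg), intervalIntegral.integral_of_le ht,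
    ← integral_Icc_eq_integral_Ioc, ofReal_integral_eq_lintegral_ofReal hcont.integrableOn_Icc
      ((ae_restrict_iff' measurableSet_Icc).2 (Eventually.of_forall hnonneg)), fellerStep]
  congr 1
  · rw [unitVec_apply]
    split_ifs <;> simp
  · refine setLIntegral_congr_fun measurableSet_Icc fun s hs => ?_
    rw [← hQ.ofReal_semigroup_offDiagRow (sub_nonneg.2 hs.2),
      ENNReal.ofReal_mul (Real.exp_pos _).le]

lemma fellerIter_le_semigroupENN (n : ℕ) {t : ℝ} (ht : 0 ≤ t) (i j : ℕ) :
    fellerIter Q n t i j ≤ hQ.semigroupENN t i j := by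
  induction n generalizing t i with
  | zero => exact zero_le
  | succ n ih =>
    rw [← hQ.fellerStep_semigroupENN ht, fellerIter_succ]
    exact fellerStep_mono (fun s hs k => ih hs k) i

lemma semigroupENN_le_fellerIter_add (n : ℕ) {t : ℝ} (ht : 0 ≤ t) (i j : ℕ) :
    hQ.semigroupENN t i j ≤
      fellerIter Q n t i j + ENNReal.ofReal ((M * t) ^ n / n.factorial) := by
  induction n generalizing t i with
  | zero =>
    have hle : hQ.semigroup t (unitVec i) j ≤ 1 :=
      calc hQ.semigroup t (unitVec i) j ≤ ‖hQ.semigroup t (unitVec i)‖ :=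
            (le_abs_self _).trans (abs_apply_le_norm _ j)
        _ ≤ 1 * ‖unitVec i‖ := (hQ.semigroup t).le_of_opNorm_le (hQ.norm_semigroup_le ht) _
        _ = 1 := by rw [one_mul, norm_unitVec]
    simpa [fellerIter, semigroupENN] using hle
  | succ n ih =>
    rw [← hQ.fellerStep_semigroupENN ht, fellerIter_succ,
      ← lintegral_pow_div_factorial (hQ.bound_nonneg i) ht]
    exact hQ.fellerStep_le_add (by fun_prop) (fun s hs k => ih hs k) i

lemma iSup_fellerIter {t : ℝ} (ht : 0 ≤ t) (i j : ℕ) :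
    ⨆ n, fellerIter Q n t i j = hQ.semigroupENN t i j := by
  refine le_antisymm (iSup_le fun n => hQ.fellerIter_le_semigroupENN n ht i j) ?_
  have hlim : Tendsto (fun n : ℕ => (⨆ n, fellerIter Q n t i j) +
      ENNReal.ofReal ((M * t) ^ n / n.factorial)) atTop (𝓝 (⨆ n, fellerIter Q n t i j)) := by
    simpa using tendsto_const_nhds.add (ENNReal.tendsto_ofReal
      (FloorSemiring.tendsto_pow_div_factorial_atTop (M * t)))
  refine ge_of_tendsto' hlim fun n => (hQ.semigroupENN_le_fellerIter_add n ht i j).trans ?_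
  gcongr
  exact le_iSup (fun n => fellerIter Q n t i j) n

lemma transition_eq {t : ℝ} (ht : 0 ≤ t) (i j : ℕ) :
    transition Q t i j = hQ.semigroup t (unitVec i) j := by
  rw [transition, hQ.iSup_fellerIter ht, semigroupENN,
    ENNReal.toReal_ofReal (hQ.isPositiveOperator_semigroup ht (unitVec_nonneg i) j)]

lemma hasSum_mul_transition {t : ℝ} (ht : 0 ≤ t) (x : ℓ¹(ℕ, ℝ)) (j : ℕ) :
    HasSum (fun i => x i * transition Q t i j) (hQ.semigroup t x j) := by
  simpa only [hQ.transition_eq ht] using hasSum_map_apply (hQ.semigroup t) x j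

lemma resolvent_eq {lam : ℝ} (hl : 0 < lam) (i j : ℕ) :
    resolvent Q lam i j = hQ.resolventOp lam (unitVec i) j := by
  rw [resolventOp_apply hQ hl]
  exact setIntegral_congr_fun measurableSet_Ioi fun t ht => by
    simp only [hQ.transition_eq (le_of_lt ht)]

end IsBoundedQMatrix

/-! ### Equilibrium in the presence of catastrophes -/

section Catastrophes

variable {β : ℝ}

lemma qCat_eq (β : ℝ) (i j : ℕ) : qCat β i j = β * (unitVec 0 j - unitVec i j) := by
  rcases i with _ | i
  · simp [qCat]
  · rcases j with _ | j
    · simp [qCat, unitVec_apply]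
    · simp [qCat, unitVec_apply, eq_comm (a := i), apply_ite (- · : ℝ → ℝ)]

lemma isBoundedQMatrix_qCat (hβ : 0 ≤ β) : IsBoundedQMatrix (qCat β) β where
  nonneg i j hij := by
    rw [qCat_eq, unitVec_apply_of_ne hij, sub_zero]
    exact mul_nonneg hβ (unitVec_nonneg 0 j)
  hasSum i := by
    simpa only [← qCat_eq, mass_unitVec, sub_self, mul_zero] using
      ((hasSum_mass (unitVec 0)).sub (hasSum_mass (unitVec i))).mul_left β
  neg_diag_le i := by
    rw [qCat_eq, unitVec_apply_self, ← mul_neg, neg_sub]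
    exact mul_le_of_le_one_right hβ (sub_le_self 1 (unitVec_nonneg 0 i))

lemma gen_qCat (hβ : 0 ≤ β) (x : ℓ¹(ℕ, ℝ)) :
    (isBoundedQMatrix_qCat hβ).gen x = β • (mass x • unitVec 0 - x) := by
  have hgen : (isBoundedQMatrix_qCat hβ).gen =
      β • (mass.smulRight (unitVec 0) - ContinuousLinearMap.id ℝ ℓ¹(ℕ, ℝ)) :=
    ext_unitVec fun i => by
      rw [IsBoundedQMatrix.gen_unitVec]
      ext j
      change qCat β i j = β * (mass (unitVec i) * unitVec 0 j - unitVec i j)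
      rw [qCat_eq, mass_unitVec, one_mul]
  simp [hgen]

namespace IsBoundedQMatrix

variable {Q : ℕ → ℕ → ℝ} {M : ℝ} (hQ : IsBoundedQMatrix Q M)

include hQ in
lemma add_qCat (hβ : 0 ≤ β) : IsBoundedQMatrix (Q + qCat β) (M + β) :=
  hQ.add (isBoundedQMatrix_qCat hβ)

lemma gen_add_qCat (hβ : 0 ≤ β) (x : ℓ¹(ℕ, ℝ)) :
    (hQ.add_qCat hβ).gen x = hQ.gen x + β • (mass x • unitVec 0 - x) := by
  rw [gen_add hQ (isBoundedQMatrix_qCat hβ), add_apply, gen_qCat hβ]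

lemma semigroup_add_qCat_apply (hβ : 0 ≤ β) {x : ℓ¹(ℕ, ℝ)} (hx : mass x = 0) (t : ℝ) :
    (hQ.add_qCat hβ).semigroup t x = Real.exp (-(β * t)) • hQ.semigroup t x := by
  set D : ℓ¹(ℕ, ℝ) →L[ℝ] ℓ¹(ℕ, ℝ) := t • hQ.gen + (-(β * t)) • 1
  have hmaps : MapsTo D {y | mass y = 0} {y | mass y = 0} := fun y (hy : mass y = 0) => by
    simp [D, hy]
  have heq : EqOn (t • (hQ.add_qCat hβ).gen : ℓ¹(ℕ, ℝ) →L[ℝ] ℓ¹(ℕ, ℝ)) D {y | mass y = 0} :=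
    fun y (hy : mass y = 0) => by
      simp only [D, smul_apply, add_apply, gen_add_qCat hQ hβ, hy, one_apply_eq_self]
      module
  rw [semigroup, exp_apply_eq_of_eqOn hmaps heq hx, exp_add_smul_one]
  rfl

lemma norm_semigroup_add_qCat_apply_le (hβ : 0 ≤ β) {x : ℓ¹(ℕ, ℝ)} (hx : mass x = 0) {t : ℝ}
    (ht : 0 ≤ t) : ‖(hQ.add_qCat hβ).semigroup t x‖ ≤ Real.exp (-(β * t)) * ‖x‖ := by
  rw [semigroup_add_qCat_apply hQ hβ hx, norm_smul, Real.norm_of_nonneg (Real.exp_pos _).le]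
  gcongr
  simpa using (hQ.semigroup t).le_of_opNorm_le (hQ.norm_semigroup_le ht) x

lemma tendsto_semigroup_add_qCat (hβ : 0 < β) {x y : ℓ¹(ℕ, ℝ)}
    (hx : (hQ.add_qCat hβ.le).gen x = 0) (hxy : mass y = mass x) :
    Tendsto (fun t => (hQ.add_qCat hβ.le).semigroup t y) atTop (𝓝 x) := by
  have hlim : Tendsto (fun t => Real.exp (-(β * t)) * ‖y - x‖) atTop (𝓝 0) := by
    simpa using (tendsto_exp_neg_mul_atTop hβ).mul_const ‖y - x‖
  have hmass : mass (y - x) = 0 := by rw [map_sub, hxy, sub_self]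
  rw [tendsto_iff_norm_sub_tendsto_zero]
  refine squeeze_zero' (Eventually.of_forall fun _ => norm_nonneg _) ?_ hlim
  filter_upwards [eventually_ge_atTop 0] with t ht
  simpa [semigroup_apply_of_gen_eq_zero _ hx] using
    hQ.norm_semigroup_add_qCat_apply_le hβ.le hmass ht

lemma isStationaryDistribution {x : ℓ¹(ℕ, ℝ)} (hx_nonneg : 0 ≤ ⇑x) (hx_mass : mass x = 1)
    (hx : hQ.gen x = 0) : IsStationaryDistribution (transition Q) x where
  nonneg := hx_nonneg
  hasSum_one := hx_mass ▸ hasSum_mass x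
  invariant t ht j := by
    simpa only [hQ.semigroup_apply_of_gen_eq_zero hx] using hQ.hasSum_mul_transition ht x j

lemma semigroup_apply_of_isStationaryDistribution {ν : ℕ → ℝ}
    (hν : IsStationaryDistribution (transition Q) ν) {t : ℝ} (ht : 0 ≤ t) :
    hQ.semigroup t (ofSummable ν hν.hasSum_one.summable) =
      ofSummable ν hν.hasSum_one.summable := by
  ext j
  exact (hQ.hasSum_mul_transition ht _ j).unique (hν.invariant t ht j)

lemma isEquilibriumDistribution_add_qCat (hβ : 0 < β) {x : ℓ¹(ℕ, ℝ)} (hx_nonneg : 0 ≤ ⇑x)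
    (hx_mass : mass x = 1) (hx : (hQ.add_qCat hβ.le).gen x = 0) :
    IsEquilibriumDistribution (transition (Q + qCat β)) x where
  stationary := isStationaryDistribution _ hx_nonneg hx_mass hx
  unique ν hν := by
    have hlim := hQ.tendsto_semigroup_add_qCat hβ hx
      ((mass_ofSummable hν.hasSum_one).trans hx_mass.symm)
    have hconst : Tendsto (fun _ : ℝ => ofSummable ν hν.hasSum_one.summable) atTop (𝓝 x) :=
      hlim.congr' <| (eventually_ge_atTop 0).mono fun t ht =>
        semigroup_apply_of_isStationaryDistribution _ hν ht
    exact congrArg Subtype.val (tendsto_nhds_unique tendsto_const_nhds hconst)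
  limit i j := by
    have hlim := ((coord j).continuous.tendsto x).comp
      (hQ.tendsto_semigroup_add_qCat hβ hx ((mass_unitVec i).trans hx_mass.symm))
    refine hlim.congr' <| (eventually_ge_atTop 0).mono fun t ht => ?_
    exact ((hQ.add_qCat hβ.le).transition_eq ht i j).symm

end IsBoundedQMatrix

end Catastrophes

/-! ### The stationary vector of the queue -/

section Resurrection

variable {h : ℕ → ℝ}

/-- The resurrection rates `(0, h₁, h₂, …)` as an element of `ℓ¹`. -/
noncomputable def resVec (h : ℕ → ℝ) (hh : Summable h) : ℓ¹(ℕ, ℝ) :=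
  ofSummable (Function.update h 0 0) (hh.update 0 0)

lemma resVec_zero (hh : Summable h) : resVec h hh 0 = 0 := rfl

lemma resVec_succ (hh : Summable h) (j : ℕ) : resVec h hh (j + 1) = h (j + 1) := rfl

lemma resVec_nonneg (hh : Summable h) (hh_nonneg : ∀ j, 1 ≤ j → 0 ≤ h j) : 0 ≤ ⇑(resVec h hh)
  | 0 => le_rfl
  | j + 1 => hh_nonneg (j + 1) (Nat.le_add_left 1 j)

lemma mass_resVec (hh : Summable h) : mass (resVec h hh) = hTotal h := by
  rw [← (hasSum_mass _).tsum_eq, (hasSum_mass _).summable.tsum_eq_zero_add, resVec_zero, zero_add]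
  rfl

lemma qRes_zero (hh : Summable h) (j : ℕ) :
    qRes h 0 j = resVec h hh j - hTotal h * unitVec 0 j := by
  rcases j with _ | j
  · simp [qRes, resVec_zero]
  · simp [qRes, resVec_succ, unitVec_apply]

lemma qRes_of_ne_zero {i : ℕ} (hi : i ≠ 0) (j : ℕ) : qRes h i j = 0 := if_neg hi

lemma isBoundedQMatrix_qRes (hh_nonneg : ∀ j, 1 ≤ j → 0 ≤ h j) (hh : Summable h) :
    IsBoundedQMatrix (qRes h) (hTotal h) where
  nonneg i j hij := by
    simp only [qRes]
    split_ifs with hi hj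
    · exact absurd (hi.trans hj.symm) hij
    · exact hh_nonneg j (by omega)
    · exact le_rfl
  hasSum i := by
    change HasSum (fun j => qRes h i j) 0
    rcases eq_or_ne i 0 with rfl | hi
    · simpa [qRes_zero hh, mass_resVec] using
        (hasSum_mass (resVec h hh)).sub ((hasSum_mass (unitVec 0)).mul_left (hTotal h))
    · simpa only [qRes_of_ne_zero hi] using (hasSum_zero : HasSum (fun _ : ℕ => (0 : ℝ)) 0)
  neg_diag_le i := by
    have hpos : 0 ≤ hTotal h := tsum_nonneg fun j => hh_nonneg _ (by omega)
    simp only [qRes]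
    split_ifs <;> simp [hpos]

lemma gen_qRes (hh_nonneg : ∀ j, 1 ≤ j → 0 ≤ h j) (hh : Summable h) (x : ℓ¹(ℕ, ℝ)) :
    (isBoundedQMatrix_qRes hh_nonneg hh).gen x = x 0 • (resVec h hh - hTotal h • unitVec 0) := by
  have hgen : (isBoundedQMatrix_qRes hh_nonneg hh).gen =
      (coord 0).smulRight (resVec h hh - hTotal h • unitVec 0) :=
    ext_unitVec fun i => by
      rw [IsBoundedQMatrix.gen_unitVec]
      ext j
      change qRes h i j = unitVec i 0 * (resVec h hh j - hTotal h * unitVec 0 j)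
      rcases eq_or_ne i 0 with rfl | hi
      · simp [qRes_zero hh]
      · simp [qRes_of_ne_zero hi, unitVec_apply_of_ne hi]
  simp [hgen]

namespace IsBoundedQMatrix

variable {Q : ℕ → ℕ → ℝ} {M β : ℝ} (hQ : IsBoundedQMatrix Q M) (hh : Summable h)

lemma hasSum_mul_resolvent (hβ : 0 < β) (j : ℕ) :
    HasSum (fun i => h (i + 1) * resolvent Q β (i + 1) j)
      (hQ.resolventOp β (resVec h hh) j) := by
  have hsum := (hasSum_nat_add_iff' 1).2 (hasSum_map_apply (hQ.resolventOp β) (resVec h hh) j)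
  simpa [resVec_zero, resVec_succ, hQ.resolvent_eq hβ] using hsum

/-- For `Q` absorbed at `0`, the invariant vector of `Q + qRes h + qCat β` normalised to be `1` at
`0`: the `β`-resolvent of `Q` applied to the resurrection rates, with its entry at `0` replaced. -/
noncomputable def invariantVec (β : ℝ) : ℓ¹(ℕ, ℝ) :=
  hQ.resolventOp β (resVec h hh) + (1 - hQ.resolventOp β (resVec h hh) 0) • unitVec 0

lemma invariantVec_apply (j : ℕ) : hQ.invariantVec hh β j = hQ.resolventOp β (resVec h hh) j +
    (1 - hQ.resolventOp β (resVec h hh) 0) * unitVec 0 j := rfl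

lemma invariantVec_zero : hQ.invariantVec hh β 0 = 1 := by simp [invariantVec_apply]

lemma invariantVec_of_ne_zero {j : ℕ} (hj : j ≠ 0) :
    hQ.invariantVec hh β j = hQ.resolventOp β (resVec h hh) j := by
  simp [invariantVec_apply, unitVec_apply_of_ne hj.symm]

variable (hh_nonneg : ∀ j, 1 ≤ j → 0 ≤ h j)

include hh_nonneg in
lemma invariantVec_nonneg (hβ : 0 < β) : 0 ≤ ⇑(hQ.invariantVec hh β) := fun j => by
  rcases eq_or_ne j 0 with rfl | hj
  · simp [invariantVec_zero]
  · rw [invariantVec_of_ne_zero hQ hh hj]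
    exact hQ.isPositiveOperator_resolventOp hβ (resVec_nonneg hh hh_nonneg) j

lemma gen_invariantVec (hQ_zero : ∀ j, Q 0 j = 0) (hβ : 0 < β) :
    ((hQ.add (isBoundedQMatrix_qRes hh_nonneg hh)).add_qCat hβ.le).gen
      (hQ.invariantVec hh β) = 0 := by
  set G := (hQ.add (isBoundedQMatrix_qRes hh_nonneg hh)).add_qCat hβ.le
  set y := hQ.resolventOp β (resVec h hh)
  have hgenQ : hQ.gen (hQ.invariantVec hh β) = β • y - resVec h hh := by
    rw [invariantVec, map_add, map_smul, gen_unitVec, hQ.row_eq_zero hQ_zero, smul_zero, add_zero,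
      hQ.gen_resolventOp hβ]
  obtain ⟨a, ha⟩ : ∃ a : ℝ, G.gen (hQ.invariantVec hh β) = a • unitVec 0 := by
    refine ⟨β * mass (hQ.invariantVec hh β) - hTotal h - β * (1 - y 0), ?_⟩
    rw [gen_add_qCat (hQ.add (isBoundedQMatrix_qRes hh_nonneg hh)) hβ.le,
      gen_add hQ (isBoundedQMatrix_qRes hh_nonneg hh), add_apply, gen_qRes hh_nonneg hh, hgenQ,
      invariantVec_zero]
    generalize mass (hQ.invariantVec hh β) = m
    rw [invariantVec]
    module
  have hmass := G.mass_gen (hQ.invariantVec hh β)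
  rw [ha, map_smul, mass_unitVec, smul_eq_mul, mul_one] at hmass
  rw [ha, hmass, zero_smul]

lemma exists_gen_eq_zero (hQ_zero : ∀ j, Q 0 j = 0) (hβ : 0 < β) :
    ∃ x : ℓ¹(ℕ, ℝ), 0 ≤ ⇑x ∧ mass x = 1 ∧
      ((hQ.add (isBoundedQMatrix_qRes hh_nonneg hh)).add_qCat hβ.le).gen x = 0 ∧
      ∀ j, j ≠ 0 → x j = x 0 * hQ.resolventOp β (resVec h hh) j := by
  set w := hQ.invariantVec hh β
  have hw_zero : w 0 = 1 := hQ.invariantVec_zero hh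
  have hw_nonneg : 0 ≤ ⇑w := hQ.invariantVec_nonneg hh hh_nonneg hβ
  have hw_mass : 0 < mass w :=
    zero_lt_one.trans_le (hw_zero ▸ le_hasSum (hasSum_mass w) 0 fun j _ => hw_nonneg j)
  refine ⟨(mass w)⁻¹ • w, fun j => mul_nonneg (inv_nonneg.2 hw_mass.le) (hw_nonneg j), ?_, ?_,
    fun j hj => ?_⟩
  · rw [map_smul, smul_eq_mul, inv_mul_cancel₀ hw_mass.ne']
  · rw [map_smul, gen_invariantVec hQ hh hh_nonneg hQ_zero hβ, smul_zero]
  · change (mass w)⁻¹ * w j = (mass w)⁻¹ * w 0 * _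
    rw [hw_zero, mul_one, hQ.invariantVec_of_ne_zero hh hj]

end IsBoundedQMatrix

end Resurrection

/-! ### The `q`-matrix of the stopped queue -/

section GeneratingFunctional

variable {s : ℝ}

/-- The value at `s ∈ [-1, 1]` of the generating function, as a functional on `ℓ¹`. -/
noncomputable def genFun (hs : |s| ≤ 1) : ℓ¹(ℕ, ℝ) →L[ℝ] ℝ :=
  ofRows ⟨fun k => s ^ k, memℓp_infty ⟨1, forall_mem_range.2 fun k => by
    simpa using pow_le_one₀ (abs_nonneg s) hs⟩⟩

@[simp] lemma genFun_unitVec (hs : |s| ≤ 1) (i : ℕ) : genFun hs (unitVec i) = s ^ i :=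
  ofRows_unitVec _ i

lemma hasSum_genFun (hs : |s| ≤ 1) (x : ℓ¹(ℕ, ℝ)) :
    HasSum (fun j => x j * s ^ j) (genFun hs x) := by
  simpa only [genFun_unitVec, smul_eq_mul] using hasSum_map (genFun hs) x

lemma genFun_resVec {h : ℕ → ℝ} (hh : Summable h) (hs : |s| ≤ 1) :
    genFun hs (resVec h hh) = genH h s := by
  have hsum := hasSum_genFun hs (resVec h hh)
  rw [← hsum.tsum_eq, hsum.summable.tsum_eq_zero_add, resVec_zero, zero_mul, zero_add]
  rfl

end GeneratingFunctional

section StoppedQueue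

variable {c : ℕ} {b : ℕ → ℝ} {s : ℝ}

lemma hasSum_genB (hb : Summable b) (hs : |s| ≤ 1) : HasSum (fun j => b j * s ^ j) (genB b s) :=
  (hasSum_genFun hs (ofSummable b hb)).summable.hasSum

lemma genB_one (hb : HasSum b 0) : genB b 1 = 0 := by simpa [genB] using hb.tsum_eq

lemma genBi_one (hb : HasSum b 0) (i : ℕ) : genBi b i 1 = 0 := by simp [genBi, genB_one hb]

lemma genU_one (hb : HasSum b 0) (β : ℝ) : genU c b β 1 = -β := by simp [genU, genBi_one hb]

lemma hasSum_zero_of_apply_one_eq (hb : Summable b) (hb_one : -b 1 = b 0 + ∑' j, b (j + 2)) :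
    HasSum b 0 := by
  have hsplit := hb.sum_add_tsum_nat_add 2
  rw [Finset.sum_range_succ, Finset.sum_range_one] at hsplit
  have hzero : ∑' j, b j = 0 := by linarith
  exact hzero ▸ hb.hasSum

lemma apply_one_nonpos (hb_nonneg : ∀ j, j ≠ 1 → 0 ≤ b j) (hb : HasSum b 0) : b 1 ≤ 0 :=
  le_hasSum hb 1 hb_nonneg

lemma qStar_zero (j : ℕ) : qStar c b 0 j = 0 := if_pos rfl

lemma qStar_succ_of_lt {n j : ℕ} (hj : j < n) : qStar c b (n + 1) j = 0 := by
  simp [qStar, hj.ne, show j ≠ n + 1 by omega, show ¬ n + 1 < j by omega]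

lemma qStar_succ_add (n k : ℕ) : qStar c b (n + 1) (n + k) = b k +
    (((min (n + 1) c : ℕ) : ℝ) - 1) * b 0 * (unitVec 0 k - unitVec 1 k) := by
  rcases k with _ | _ | k
  · simp [qStar, unitVec_apply]
    ring
  · simp [qStar, unitVec_apply]
    ring
  · simp [qStar, unitVec_apply, show n + (k + 1 + 1) - (n + 1) + 1 = k + 2 by omega]

lemma hasSum_qStar_succ (hb : Summable b) (hs : |s| ≤ 1) (n : ℕ) :
    HasSum (fun j => qStar c b (n + 1) j * s ^ j) (s ^ n * genBi b (min (n + 1) c) s) := by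
  have hsupport : ∀ j ∉ range (n + ·), qStar c b (n + 1) j * s ^ j = 0 := fun j hj => by
    rw [qStar_succ_of_lt, zero_mul]
    by_contra! hn
    exact hj ⟨j - n, Nat.add_sub_cancel' hn⟩
  rw [← (add_right_injective n).hasSum_iff hsupport]
  have hdiff : HasSum (fun k => (unitVec 0 k - unitVec 1 k) * s ^ k) (1 - s) := by
    simpa only [genFun_unitVec, pow_zero, pow_one, ← sub_mul] using
      (hasSum_genFun hs (unitVec 0)).sub (hasSum_genFun hs (unitVec 1))
  have hsum : HasSum (fun k => s ^ n * (b k * s ^ k + (((min (n + 1) c : ℕ) : ℝ) - 1) * b 0 *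
      ((unitVec 0 k - unitVec 1 k) * s ^ k))) (s ^ n * genBi b (min (n + 1) c) s) :=
    ((hasSum_genB hb hs).add (hdiff.mul_left _)).mul_left (s ^ n)
  convert hsum using 2 with k
  rw [Function.comp_apply, qStar_succ_add]
  ring

lemma isBoundedQMatrix_qStar (c : ℕ) (hb_nonneg : ∀ j, j ≠ 1 → 0 ≤ b j) (hb : HasSum b 0) :
    IsBoundedQMatrix (qStar c b) (-b 1 + c * b 0) where
  nonneg i j hij := by
    have hb_zero := hb_nonneg 0 zero_ne_one
    simp only [qStar]
    split_ifs with _ _ hji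
    · exact le_rfl
    · positivity
    · exact absurd hji.symm hij
    · exact hb_nonneg _ (by omega)
    · exact le_rfl
  hasSum i := by
    rcases i with _ | i
    · exact (funext qStar_zero : qStar c b 0 = 0) ▸ hasSum_zero
    · simpa [genBi_one hb] using hasSum_qStar_succ (c := c) hb.summable (s := 1) (by simp) i
  neg_diag_le i := by
    have hb_zero := hb_nonneg 0 zero_ne_one
    have hb_one := apply_one_nonpos hb_nonneg hb
    have hmin : ((min i c : ℕ) : ℝ) * b 0 ≤ c * b 0 := by gcongr; exact min_le_right i c
    rcases eq_or_ne i 0 with rfl | hi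
    · rw [qStar_zero]
      nlinarith [Nat.cast_nonneg (α := ℝ) c]
    · simp only [qStar, if_neg hi, if_neg i.succ_ne_self, if_true]
      linarith

end StoppedQueue

/-! ### The root `u(β)` -/

lemma injOn_of_convexOn_Icc {f : ℝ → ℝ} {l r : ℝ} (hf : ConvexOn ℝ (Icc l r) f) :
    InjOn f {x ∈ Icc l r | f r < f x} := by
  rintro x ⟨hx, hrx⟩ y ⟨hy, hry⟩ hxy
  by_contra hne
  wlog hlt : x < y generalizing x y
  · exact this hy hry hx hrx hxy.symm (Ne.symm hne) (lt_of_le_of_ne (not_lt.1 hlt) (Ne.symm hne))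
  have hyr : y < r := hy.2.lt_of_ne fun h => hry.ne (h ▸ rfl)
  have hmem : y ∈ openSegment ℝ x r := openSegment_eq_Ioo (hlt.trans hyr) ▸ ⟨hlt, hyr⟩
  exact (hf.lt_left_of_right_lt hx ⟨hx.1.trans hx.2, le_rfl⟩ hmem hry).ne hxy.symm

section Root

variable {c : ℕ} {b : ℕ → ℝ} {β s : ℝ}

lemma continuousOn_genB (hb : Summable b) : ContinuousOn (genB b) (Icc (-1) 1) := by
  refine continuousOn_tsum (u := fun j => |b j|) (fun j => by fun_prop) hb.abs fun j s hs => ?_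
  rw [norm_mul, norm_pow, Real.norm_eq_abs, Real.norm_eq_abs]
  exact mul_le_of_le_one_right (abs_nonneg _) (pow_le_one₀ (abs_nonneg _) (abs_le.2 hs))

lemma continuousOn_genU (hb : Summable b) : ContinuousOn (genU c b β) (Icc (-1) 1) := by
  have hB := continuousOn_genB hb
  unfold genU genBi
  fun_prop

lemma convexOn_genB (hb_nonneg : ∀ j, j ≠ 1 → 0 ≤ b j) (hb : Summable b) :
    ConvexOn ℝ (Icc 0 1) (genB b) := by
  have hterm : ∀ j, ConvexOn ℝ (Icc 0 1) fun s : ℝ => b j * s ^ j := fun j => by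
    rcases eq_or_ne j 1 with rfl | hj
    · simp only [pow_one]
      exact (LinearMap.mulLeft ℝ (b 1)).convexOn (convex_Icc 0 1)
    · exact ((convexOn_pow j).subset Icc_subset_Ici_self (convex_Icc 0 1)).smul (hb_nonneg j hj)
  have hsum : ∀ {s}, s ∈ Icc (0 : ℝ) 1 → HasSum (fun j => b j * s ^ j) (genB b s) :=
    fun hs => hasSum_genB hb (abs_le.2 ⟨by linarith [hs.1], hs.2⟩)
  refine ⟨convex_Icc 0 1, fun x hx y hy p q hp hq hpq => ?_⟩
  exact hasSum_le (fun j => (hterm j).2 hx hy hp hq hpq)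
    (hsum (convex_Icc 0 1 hx hy hp hq hpq)) (((hsum hx).mul_left p).add ((hsum hy).mul_left q))

lemma convexOn_genU (hb_nonneg : ∀ j, j ≠ 1 → 0 ≤ b j) (hb : Summable b) :
    ConvexOn ℝ (Icc 0 1) (genU c b β) := by
  refine ⟨convex_Icc 0 1, fun x hx y hy p q hp hq hpq => ?_⟩
  have hB := (convexOn_genB hb_nonneg hb).2 hx hy hp hq hpq
  obtain rfl : q = 1 - p := by linarith
  simp only [genU, genBi, smul_eq_mul] at hB ⊢
  linarith

lemma mul_one_sub_le_genB (hb_nonneg : ∀ j, j ≠ 1 → 0 ≤ b j) (hb : HasSum b 0)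
    (hs : s ∈ Icc (-1) 0) : b 0 * (1 - s) ≤ genB b s := by
  have hs_abs : |s| ≤ 1 := abs_le.2 ⟨hs.1, hs.2.trans zero_le_one⟩
  have hpow : ∀ j, j ≠ 0 → s ≤ s ^ j := fun j hj => by
    have habs : |s ^ j| ≤ |s| := abs_pow s j ▸ pow_le_of_le_one (abs_nonneg s) hs_abs hj
    linarith [neg_abs_le (s ^ j), abs_of_nonpos hs.2]
  have hsum := (hb.mul_right s).add (hasSum_ite_eq 0 (b 0 * (1 - s)))
  rw [zero_mul, zero_add] at hsum
  refine hasSum_le (fun j => ?_) hsum (hasSum_genB hb.summable hs_abs)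
  rcases j with _ | _ | j
  · simp [mul_sub]
  · simp
  · simpa using mul_le_mul_of_nonneg_left (hpow (j + 2) (by omega)) (hb_nonneg (j + 2) (by omega))

lemma genU_pos_of_nonpos (hc : 1 ≤ c) (hb_nonneg : ∀ j, j ≠ 1 → 0 ≤ b j) (hb : HasSum b 0)
    (hb_zero : 0 < b 0) (hβ : 0 ≤ β) (hs : s ∈ Icc (-1) 0) : 0 < genU c b β s := by
  have hB := mul_one_sub_le_genB hb_nonneg hb hs
  have hmain : 0 < c * (b 0 * (1 - s)) := by
    have := hs.2
    have : 0 < 1 - s := by linarith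
    positivity
  have hβs : β * s ≤ 0 := mul_nonpos_of_nonneg_of_nonpos hβ hs.2
  rw [genU, genBi]
  linarith

lemma rootU_eq {u : ℝ} (hu : u ∈ Icc (0 : ℝ) 1) (hU : genU c b β u = 0)
    (huniq : ∀ s ∈ Icc (-1 : ℝ) 1, genU c b β s = 0 → s = u) : rootU c b β = u := by
  have hset : {s | s ∈ Icc (0 : ℝ) 1 ∧ genU c b β s = 0} = {u} :=
    eq_singleton_iff_unique_mem.2 ⟨⟨hu, hU⟩, fun s hs =>
      huniq s ⟨neg_one_lt_zero.le.trans hs.1.1, hs.1.2⟩ hs.2⟩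
  rw [rootU, hset, csInf_singleton]

lemma rootU_spec (hc : 1 ≤ c) (hb_nonneg : ∀ j, j ≠ 1 → 0 ≤ b j) (hb : HasSum b 0)
    (hb_zero : 0 < b 0) (hβ : 0 < β) :
    0 < rootU c b β ∧ rootU c b β < 1 ∧ genU c b β (rootU c b β) = 0 ∧
      ∀ s ∈ Icc (-1 : ℝ) 1, s ≠ rootU c b β → genU c b β s ≠ 0 := by
  have hU_one : genU c b β 1 < 0 := by rw [genU_one hb]; exact neg_lt_zero.2 hβ
  have pos_of_root : ∀ {s}, s ∈ Icc (-1 : ℝ) 1 → genU c b β s = 0 → 0 < s := fun hs hUs => by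
    by_contra! hs_nonpos
    exact (genU_pos_of_nonpos hc hb_nonneg hb hb_zero hβ.le ⟨hs.1, hs_nonpos⟩).ne' hUs
  obtain ⟨u, hu, hU⟩ : (0 : ℝ) ∈ genU c b β '' Icc 0 1 :=
    intermediate_value_Icc' zero_le_one
      ((continuousOn_genU hb.summable).mono (Icc_subset_Icc_left neg_one_lt_zero.le))
      ⟨hU_one.le, (genU_pos_of_nonpos hc hb_nonneg hb hb_zero hβ.le (by simp)).le⟩
  have huniq : ∀ s ∈ Icc (-1 : ℝ) 1, genU c b β s = 0 → s = u := fun s hs hUs =>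
    injOn_of_convexOn_Icc (convexOn_genU hb_nonneg hb.summable)
      ⟨⟨(pos_of_root hs hUs).le, hs.2⟩, hUs ▸ hU_one⟩ ⟨hu, hU ▸ hU_one⟩ (hUs.trans hU.symm)
  rw [rootU_eq hu hU huniq]
  exact ⟨pos_of_root ⟨neg_one_lt_zero.le.trans hu.1, hu.2⟩ hU,
    hu.2.lt_of_ne fun h => hU_one.ne (h ▸ hU), hU, fun s hs hne hUs => hne (huniq s hs hUs)⟩

end Root

/-! ### The generating function of the stationary vector -/

section Stationary

variable {c : ℕ} {b h : ℕ → ℝ} {β s u : ℝ}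

/-- The generating function `∑_{k=1}^{c-1} x_k (c - k) b₀ s^{k-1}` of the unused service capacity
when the states are weighted by `x`. -/
noncomputable def genIdle (c : ℕ) (b x : ℕ → ℝ) (s : ℝ) : ℝ :=
  ∑ k ∈ Finset.Icc 1 (c - 1), x k * ((c : ℝ) - k) * b 0 * s ^ (k - 1)

lemma sum_genIdle_sub (x : ℕ → ℝ) (s u : ℝ) :
    ∑ k ∈ Finset.Icc 1 (c - 1), x k * ((c : ℝ) - k) * b 0 *
        (s ^ k * (1 - s) - s * u ^ (k - 1) * (1 - u)) =
      s * ((1 - s) * genIdle c b x s - (1 - u) * genIdle c b x u) := by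
  simp only [genIdle, Finset.mul_sum, ← Finset.sum_sub_distrib]
  refine Finset.sum_congr rfl fun k hk => ?_
  rw [← mul_pow_sub_one (Nat.one_le_iff_ne_zero.1 (Finset.mem_Icc.1 hk).1) s]
  ring

lemma bigL_eq (hb_nonneg : ∀ j, j ≠ 1 → 0 ≤ b j) (hb : HasSum b 0) (hh : Summable h)
    (hβ : 0 < β) (j : ℕ) : bigL c b h β j =
      (isBoundedQMatrix_qStar c hb_nonneg hb).resolventOp β (resVec h hh) j :=
  ((isBoundedQMatrix_qStar c hb_nonneg hb).hasSum_mul_resolvent hh hβ j).tsum_eq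

lemma mul_pow_mul_genBi_min (n : ℕ) (s : ℝ) :
    s * (s ^ n * genBi b (min (n + 1) c) s) = s ^ (n + 1) * genBi b c s -
      if n + 1 ∈ Finset.Icc 1 (c - 1) then
        ((c : ℝ) - (n + 1 : ℕ)) * b 0 * (s * (1 - s) * s ^ n) else 0 := by
  split_ifs with hn
  · rw [min_eq_left (by grind)]
    simp only [genBi]
    ring
  · rw [min_eq_right (by grind)]
    ring

lemma mul_genFun_gen_qStar (hb_nonneg : ∀ j, j ≠ 1 → 0 ≤ b j) (hb : HasSum b 0) (hs : |s| ≤ 1)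
    (x : ℓ¹(ℕ, ℝ)) : s * genFun hs ((isBoundedQMatrix_qStar c hb_nonneg hb).gen x) =
      genBi b c s * (genFun hs x - x 0) - s * (1 - s) * genIdle c b x s := by
  set hQ := isBoundedQMatrix_qStar c hb_nonneg hb
  have hop : s • (genFun hs ∘L hQ.gen) = genBi b c s • (genFun hs - coord 0) -
      ∑ k ∈ Finset.Icc 1 (c - 1),
        (((c : ℝ) - k) * b 0 * (s * (1 - s) * s ^ (k - 1))) • coord k := ext_unitVec fun i => by
    suffices hrow : s * genFun hs (hQ.row i) = genBi b c s * (s ^ i - unitVec i 0) -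
        if i ∈ Finset.Icc 1 (c - 1) then ((c : ℝ) - i) * b 0 * (s * (1 - s) * s ^ (i - 1))
        else 0 by
      simpa [unitVec_apply, sum_apply] using hrow
    rcases i with _ | n
    · simp [hQ.row_eq_zero qStar_zero]
    · rw [(hasSum_genFun hs (hQ.row (n + 1))).unique (hasSum_qStar_succ hb.summable hs n),
        mul_pow_mul_genBi_min, unitVec_apply_of_ne n.succ_ne_zero, sub_zero, Nat.add_sub_cancel]
      ring
  have happly := DFunLike.congr_fun hop x
  simp only [genIdle, Finset.mul_sum]
  simpa [mul_comm, mul_assoc, mul_left_comm] using happly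

variable {x : ℓ¹(ℕ, ℝ)} (hb_nonneg : ∀ j, j ≠ 1 → 0 ≤ b j) (hb : HasSum b 0)
  (hh_nonneg : ∀ j, 1 ≤ j → 0 ≤ h j) (hh : Summable h) (hβ : 0 ≤ β) (hx_mass : mass x = 1)
  (hx : (((isBoundedQMatrix_qStar c hb_nonneg hb).add
    (isBoundedQMatrix_qRes hh_nonneg hh)).add_qCat hβ).gen x = 0)

include hx_mass hx

lemma genU_mul_genFun_sub (hs : |s| ≤ 1) : genU c b β s * (genFun hs x - x 0) =
    s * ((1 - s) * genIdle c b x s + x 0 * (hTotal h - genH h s) - β * (1 - x 0)) := by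
  have hQ := isBoundedQMatrix_qStar c hb_nonneg hb
  have hbalance := congrArg (genFun hs) hx
  rw [IsBoundedQMatrix.gen_add_qCat (hQ.add (isBoundedQMatrix_qRes hh_nonneg hh)) hβ,
    IsBoundedQMatrix.gen_add hQ (isBoundedQMatrix_qRes hh_nonneg hh), add_apply,
    gen_qRes hh_nonneg hh, hx_mass] at hbalance
  simp only [map_add, map_sub, map_smul, map_zero, smul_eq_mul, one_mul, genFun_unitVec, pow_zero,
    genFun_resVec] at hbalance
  rw [genU]
  linear_combination s * hbalance - mul_genFun_gen_qStar hb_nonneg hb hs x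

lemma mul_one_sub_apply_zero_of_genU_eq_zero (hu : |u| ≤ 1) (hu_ne : u ≠ 0)
    (hU : genU c b β u = 0) :
    β * (1 - x 0) = (1 - u) * genIdle c b x u + x 0 * (hTotal h - genH h u) := by
  have hroot := genU_mul_genFun_sub hb_nonneg hb hh_nonneg hh hβ hx_mass hx hu
  rw [hU, zero_mul, zero_eq_mul, or_iff_right hu_ne, sub_eq_zero] at hroot
  exact hroot.symm

lemma genFun_eq (hu : |u| ≤ 1) (hu_ne : u ≠ 0) (hU : genU c b β u = 0) (hs : |s| ≤ 1)
    (hUs : genU c b β s ≠ 0) :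
    genFun hs x = x 0 * (1 + s * (genH h u - genH h s) / genU c b β s) +
      s * ((1 - s) * genIdle c b x s - (1 - u) * genIdle c b x u) / genU c b β s := by
  have hroot := mul_one_sub_apply_zero_of_genU_eq_zero hb_nonneg hb hh_nonneg hh hβ hx_mass hx
    hu hu_ne hU
  have hgen := genU_mul_genFun_sub hb_nonneg hb hh_nonneg hh hβ hx_mass hx hs
  field_simp
  linear_combination hgen - s * hroot

lemma apply_zero_eq (hβ_ne : β ≠ 0) (hu : |u| ≤ 1) (hu_ne : u ≠ 0) (hU : genU c b β u = 0)
    {L : ℕ → ℝ} (hL : ∀ j, 1 ≤ j → x j = x 0 * L j) :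
    x 0 = β * (β + genH h 1 - genH h u + ∑ k ∈ Finset.Icc 1 (c - 1),
      L k * u ^ (k - 1) * ((c : ℝ) - k) * b 0 * (1 - u))⁻¹ := by
  have hidle : (1 - u) * genIdle c b x u = x 0 * ∑ k ∈ Finset.Icc 1 (c - 1),
      L k * u ^ (k - 1) * ((c : ℝ) - k) * b 0 * (1 - u) := by
    simp only [genIdle, Finset.mul_sum]
    refine Finset.sum_congr rfl fun k hk => ?_
    rw [hL k (Finset.mem_Icc.1 hk).1]
    ring
  have hroot := mul_one_sub_apply_zero_of_genU_eq_zero hb_nonneg hb hh_nonneg hh hβ hx_mass hx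
    hu hu_ne hU
  have hmul : x 0 * (β + genH h 1 - genH h u + ∑ k ∈ Finset.Icc 1 (c - 1),
      L k * u ^ (k - 1) * ((c : ℝ) - k) * b 0 * (1 - u)) = β := by
    have hH : genH h 1 = hTotal h := by simp [genH, hTotal]
    rw [hH]
    linear_combination -hroot - hidle
  exact (eq_mul_inv_iff_mul_eq₀ (right_ne_zero_of_mul (hmul.trans_ne hβ_ne))).2 hmul

end Stationary

end MXMc

theorem theorem4p4 (c : ℕ) (hc : 1 ≤ c) (b h : ℕ → ℝ) (β : ℝ)
    (hb_nonneg : ∀ j, j ≠ 1 → 0 ≤ b j) (hb_summable : Summable b)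
    (hb_one : -b 1 = b 0 + ∑' j : ℕ, b (j + 2))
    (hb_zero : 0 < b 0) (hb_two : 0 < ∑' j : ℕ, b (j + 2))
    (hh_nonneg : ∀ j, 1 ≤ j → 0 ≤ h j) (hh_summable : Summable h)
    (hh_pos : 0 < hTotal h) (hβ : 0 < β) :
    -- `u(β)` is a root of `U_β` in `(0, 1)`, and the only one on `[-1, 1]`
    (0 < rootU c b β ∧ rootU c b β < 1 ∧ genU c b β (rootU c b β) = 0 ∧
      ∀ s ∈ Set.Icc (-1 : ℝ) 1, s ≠ rootU c b β → genU c b β s ≠ 0) ∧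
    ∃ π : ℕ → ℝ, IsEquilibriumDistribution (transition (qMatrix c b h β)) π ∧
      (∀ s ∈ Set.Icc (-1 : ℝ) 1, s ≠ rootU c b β →
        HasSum (fun k => π k * s ^ k)
          (π 0 * (1 + s * (genH h (rootU c b β) - genH h s) / genU c b β s) +
            (∑ k ∈ Finset.Icc 1 (c - 1), π k * ((c : ℝ) - k) * b 0 *
              (s ^ k * (1 - s) - s * rootU c b β ^ (k - 1) * (1 - rootU c b β))) /
              genU c b β s)) ∧
      π 0 = β * (β + genH h 1 - genH h (rootU c b β) +
        ∑ k ∈ Finset.Icc 1 (c - 1), bigL c b h β k * rootU c b β ^ (k - 1) *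
          ((c : ℝ) - k) * b 0 * (1 - rootU c b β))⁻¹ ∧
      ∀ j, 1 ≤ j → π j = π 0 * bigL c b h β j := by
  have hb : HasSum b 0 := hasSum_zero_of_apply_one_eq hb_summable hb_one
  obtain ⟨hu_pos, hu_lt, hU, huniq⟩ := rootU_spec hc hb_nonneg hb hb_zero hβ
  have hu : |rootU c b β| ≤ 1 := (abs_of_pos hu_pos).trans_le hu_lt.le
  set hQ := isBoundedQMatrix_qStar c hb_nonneg hb
  obtain ⟨x, hx_nonneg, hx_mass, hx, hx_L⟩ :=
    hQ.exists_gen_eq_zero hh_summable hh_nonneg qStar_zero hβ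
  have hx_bigL : ∀ j, 1 ≤ j → x j = x 0 * bigL c b h β j := fun j hj => by
    rw [hx_L j (Nat.one_le_iff_ne_zero.1 hj), bigL_eq hb_nonneg hb hh_summable hβ]
  have hequilibrium : IsEquilibriumDistribution (transition (qMatrix c b h β)) x :=
    (hQ.add (isBoundedQMatrix_qRes hh_nonneg hh_summable)).isEquilibriumDistribution_add_qCat hβ
      hx_nonneg hx_mass hx
  refine ⟨⟨hu_pos, hu_lt, hU, huniq⟩, x, hequilibrium, fun s hs hsu => ?_, ?_, hx_bigL⟩
  · rw [sum_genIdle_sub, ← genFun_eq hb_nonneg hb hh_nonneg hh_summable hβ.le hx_mass hx hu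
      hu_pos.ne' hU (abs_le.2 hs) (huniq s hs hsu)]
    exact hasSum_genFun (abs_le.2 hs) x
  · exact apply_zero_eq hb_nonneg hb hh_nonneg hh_summable hβ.le hx_mass hx hβ.ne' hu hu_pos.ne'
      hU hx_bigL
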